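/- All graphs are finite and simple; $P_m$ is the path on $m$ vertices. Let $s \ge 1$ be an integer and let $\mathcal{H}$ be a finite set of connected graphs with $P_s \in \mathcal{H}$. An induced $\mathcal{H}$-matching of a graph $G$ is an induced subgraph of $G$ each of whose components is isomorphic to a graph in $\mathcal{H}$; the induced $\mathcal{H}$-matching number $\alpha_{\mathcal{H}}(G)$ is the maximum number of components of an induced $\mathcal{H}$-matching of $G$. For a connected graph $H$, a non-empty set $X \subseteq V(H)$ and an integer $l \ge 1$, the $(H,X)$-broom of length $l$ is the graph obtained from the disjoint union of $H$ and a path with $l-1$ edges by joining one end of the path to all vertices of $X$; the other end of the path is the endpoint of the broom (if $l = 1$, the path is a single vertex, which is joined to $X$ and is also the endpoint). For $n \ge 1$, the $(H,X)$-hairy graph $H_n^l(H,X)$ is obtained from the complete graph on vertices $v_1,\ldots,v_n$ and $n$ disjoint $(H,X)$-brooms of length $l$ by identifying $v_i$ with the endpoint of the $i$-th broom for each $i$. The $(H,X)$-star $S_n^l(H,X)$ is obtained from $n$ disjoint $(H,X)$-brooms of length $l$ by identifying all their endpoints to a single vertex. Theorem. For every positive integer $n$ there exists an integer $N$ such that every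 connected graph $G$ with $\alpha_{\mathcal{H}}(G) \ge N$ contains an induced subgraph isomorphic to one of the following: (i) $P_n$, (ii) $H_n^l(H,X)$ for some $1 \le l \le s$, some $H \in \mathcal{H}$ and some non-empty $X \subseteq V(H)$, or (iii) $S_n^l(H,X)$ for some $1 \le l \le s$, some $H \in \mathcal{H}$ and some non-empty $X \subseteq V(H)$. -/

import Mathlib

namespace InducedPacking

/-- A vertex set `S` of `G` such that the subgraph of `G` induced on `S` is an induced
`H`-matching: each of its components is isomorphic to a member of the family `H`. -/
def IsInducedMatching {ι : Type*} {W : ι → Type*} (H : ∀ i, SimpleGraph (W i))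
    {V : Type*} (G : SimpleGraph V) (S : Set V) : Prop :=
  ∀ c : (G.induce S).ConnectedComponent, ∃ i, Nonempty (c.toSimpleGraph ≃g H i)

/-- The induced `H`-matching number of a finite graph `G`: the maximum number of components
of an induced `H`-matching of `G`. -/
noncomputable def inducedMatchingNumber {ι : Type*} {W : ι → Type*}
    (H : ∀ i, SimpleGraph (W i)) {V : Type*} (G : SimpleGraph V) : ℕ :=
  sSup {k | ∃ S : Set V, IsInducedMatching H G S ∧
    Nat.card (G.induce S).ConnectedComponent = k}

/-- The `(H, X)`-broom of length `l ≥ 1`: a path with `l` vertices `0, …, l - 1` (hence with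
`l - 1` edges) together with a disjoint copy of `H`, where the last vertex `l - 1` of the path
is joined to all vertices in `X`. -/
def broom {W : Type*} (H : SimpleGraph W) (X : Set W) (l : ℕ) : SimpleGraph (Fin l ⊕ W) where
  Adj
    | .inl a, .inl b => (SimpleGraph.pathGraph l).Adj a b
    | .inr x, .inr y => H.Adj x y
    | .inl a, .inr x => a.val + 1 = l ∧ x ∈ X
    | .inr x, .inl a => a.val + 1 = l ∧ x ∈ X
  symm := ⟨by
    rintro (a | x) (b | y) h
    · exact SimpleGraph.Adj.symm h
    · exact h
    · exact h
    · exact SimpleGraph.Adj.symm h⟩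
  loopless := ⟨by
    rintro (a | x) h
    · exact SimpleGraph.irrefl _ h
    · exact SimpleGraph.irrefl _ h⟩

/-- The endpoint of a broom: the end of the path that is opposite to the copy of `H`
(the only vertex of the path if `l = 1`). -/
def broomEndpoint (W : Type*) {l : ℕ} (hl : 0 < l) : Fin l ⊕ W := .inl ⟨0, hl⟩

/-- The graph obtained from a complete graph on `n` vertices by identifying its `i`-th vertex
with the vertex `r` of the `i`-th of `n` disjoint copies of `B`. -/
def cliqueOfCopies {β : Type*} (n : ℕ) (B : SimpleGraph β) (r : β) :
    SimpleGraph (Fin n × β) where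
  Adj p q := (p.1 = q.1 ∧ B.Adj p.2 q.2) ∨ (p.1 ≠ q.1 ∧ p.2 = r ∧ q.2 = r)
  symm := ⟨by
    rintro p q (⟨h, h'⟩ | ⟨h, hp, hq⟩)
    · exact Or.inl ⟨h.symm, h'.symm⟩
    · exact Or.inr ⟨h.symm, hq, hp⟩⟩
  loopless := ⟨by
    rintro p (⟨_, h⟩ | ⟨h, _⟩)
    · exact SimpleGraph.irrefl _ h
    · exact h rfl⟩

/-- The graph obtained from `n` disjoint copies of `B` by identifying the `n` copies of the
vertex `r` to a single vertex, here `none`. -/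
def starOfCopies {β : Type*} (n : ℕ) (B : SimpleGraph β) (r : β) :
    SimpleGraph (Option (Fin n × {b : β // b ≠ r})) where
  Adj
    | none, none => False
    | none, some q => B.Adj r q.2
    | some p, none => B.Adj p.2 r
    | some p, some q => p.1 = q.1 ∧ B.Adj p.2 q.2
  symm := ⟨by
    rintro (_ | p) (_ | q) h
    · exact h
    · exact SimpleGraph.Adj.symm h
    · exact SimpleGraph.Adj.symm h
    · exact ⟨h.1.symm, SimpleGraph.Adj.symm h.2⟩⟩
  loopless := ⟨by
    rintro (_ | p) h
    · exact h
    · exact SimpleGraph.irrefl _ h.2⟩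

/-- The `(H, X)`-hairy graph with width `n` and length `l`. -/
def hairyGraph {W : Type*} (H : SimpleGraph W) (X : Set W) (n : ℕ) {l : ℕ} (hl : 0 < l) :
    SimpleGraph (Fin n × (Fin l ⊕ W)) :=
  cliqueOfCopies n (broom H X l) (broomEndpoint W hl)

/-- The `(H, X)`-star with `n` leaves and length `l`. -/
def starGraph {W : Type*} (H : SimpleGraph W) (X : Set W) (n : ℕ) {l : ℕ} (hl : 0 < l) :
    SimpleGraph (Option (Fin n × {b : Fin l ⊕ W // b ≠ broomEndpoint W hl})) :=
  starOfCopies n (broom H X l) (broomEndpoint W hl)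

end InducedPacking

/-! Fix a root `r`. Without an induced `P_n`, every vertex is at distance less than `n` from `r`,
since a geodesic is an induced path. By pigeonhole, a large induced matching then contains many
copies of a single `H i`, all at the same distance from `r`: a family of brooms of length `0`.

Pull such a family towards `r` (`exists_family_step`): each broom has a neighbour one level closer.
By Ramsey (`exists_attachment_dichotomy`), either one of these neighbours sees many brooms, which
gives a star, or many of them see only their own broom and form a clique, which gives a hairy graph,
or an independent set, which gives longer brooms one level closer. At length `s` the brooms are cut
down to their paths, which are copies of `P_s` and hence brooms of length `0` again. This keeps all
lengths at most `s`. The distance drops at every step and cannot reach `0`, because two disjoint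
brooms cannot both contain `r`. -/

namespace InducedPacking

open SimpleGraph

/-! ### Ramsey and pigeonhole arguments. -/

section Ramsey

/-- Ramsey's theorem for two colours, on the increasing pairs of a linear order. -/
theorem exists_ramsey (a b : ℕ) : ∃ N : ℕ, ∀ {α : Type} [LinearOrder α] (P : α → α → Prop)
    (S : Finset α), N ≤ S.card →
      (∃ T ⊆ S, T.card = a ∧ ∀ i ∈ T, ∀ j ∈ T, i < j → P i j) ∨
      (∃ T ⊆ S, T.card = b ∧ ∀ i ∈ T, ∀ j ∈ T, i < j → ¬ P i j) := by
  classical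
  induction a generalizing b with
  | zero => exact ⟨0, fun P S _ => Or.inl ⟨∅, by simp, by simp, by simp⟩⟩
  | succ a iha =>
    induction b with
    | zero => exact ⟨0, fun P S _ => Or.inr ⟨∅, by simp, by simp, by simp⟩⟩
    | succ b ihb =>
      obtain ⟨N₁, h₁⟩ := iha (b + 1)
      obtain ⟨N₂, h₂⟩ := ihb
      -- The 1 pays for the least element `x`; the rest splits according to `P x`, and `x` extends a
      -- set found on the matching side.
      refine ⟨N₁ + N₂ + 1, fun {α} _ P S hS => ?_⟩
      have hne : S.Nonempty := Finset.card_pos.mp (by omega)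
      set x := S.min' hne with hx
      have hxS : x ∈ S := S.min'_mem hne
      have hlt : ∀ i ∈ S.erase x, x < i := fun i hi =>
        lt_of_le_of_ne (S.min'_le i (Finset.mem_of_mem_erase hi)) (Finset.ne_of_mem_erase hi).symm
      have hc := Finset.card_filter_add_card_filter_not (s := S.erase x) (P x)
      rw [Finset.card_erase_of_mem hxS] at hc
      have insert_case : ∀ (Q : α → α → Prop) (T : Finset α) (k : ℕ),
          T ⊆ (S.erase x).filter (Q x) → T.card = k → (∀ i ∈ T, ∀ j ∈ T, i < j → Q i j) →
          ∃ T ⊆ S, T.card = k + 1 ∧ ∀ i ∈ T, ∀ j ∈ T, i < j → Q i j := by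
        intro Q T k hT hk hQ
        have hT' : ∀ i ∈ T, i ∈ S.erase x ∧ Q x i := fun i hi => Finset.mem_filter.mp (hT hi)
        refine ⟨insert x T, ?_, ?_, ?_⟩
        · intro i hi
          rcases Finset.mem_insert.mp hi with rfl | hi
          · exact hxS
          · exact Finset.mem_of_mem_erase (hT' i hi).1
        · rw [Finset.card_insert_of_notMem, hk]
          exact fun h => Finset.notMem_erase x S (hT' x h).1
        · intro i hi j hj hij
          rcases Finset.mem_insert.mp hi with hi | hi <;> rcases Finset.mem_insert.mp hj with hj | hj
          · exact absurd hij (by rw [hi, hj]; exact lt_irrefl _)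
          · rw [hi]; exact (hT' j hj).2
          · rw [hj] at hij
            exact absurd hij (hlt i (hT' i hi).1).asymm
          · exact hQ i hi j hj hij
      have sub : ∀ Q : α → Prop, [DecidablePred Q] → (S.erase x).filter Q ⊆ S := fun Q _ =>
        (Finset.filter_subset _ _).trans (Finset.erase_subset _ _)
      by_cases hcase : N₁ ≤ ((S.erase x).filter (P x)).card
      · rcases h₁ P _ hcase with ⟨T, hT, hTc, hTP⟩ | ⟨T, hT, hTc, hTP⟩
        · exact Or.inl (insert_case P T a hT hTc hTP)
        · exact Or.inr ⟨T, hT.trans (sub _), hTc, hTP⟩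
      · rcases h₂ P ((S.erase x).filter fun i => ¬ P x i) (by omega) with
          ⟨T, hT, hTc, hTP⟩ | ⟨T, hT, hTc, hTP⟩
        · exact Or.inl ⟨T, hT.trans (sub _), hTc, hTP⟩
        · exact Or.inr (insert_case (fun i j => ¬ P i j) T b (by convert hT) hTc hTP)

theorem exists_embedding_of_card_le {M m : ℕ} {T : Finset (Fin M)} (h : m ≤ T.card) :
    ∃ f : Fin m ↪ Fin M, ∀ k, f k ∈ T :=
  ⟨(Fin.castLEEmb h).trans (T.orderEmbOfFin rfl).toEmbedding, fun _ =>
    T.orderEmbOfFin_mem rfl _⟩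

theorem exists_embedding_const {α : Type*} [Finite α] {M m : ℕ} (g : Fin M → α) [Nonempty α]
    (h : Nat.card α * m ≤ M) : ∃ (a : α) (f : Fin m ↪ Fin M), ∀ k, g (f k) = a := by
  classical
  have := Fintype.ofFinite α
  obtain ⟨a, ha⟩ := Fintype.exists_le_card_fiber_of_mul_le_card g (n := m)
    (by simpa [Nat.card_eq_fintype_card] using h)
  obtain ⟨f, hf⟩ := exists_embedding_of_card_le ha
  exact ⟨a, f, fun k => by simpa using hf k⟩

/-- Given many vertex sets, the `i`-th one (indexed by `β i`) having a neighbour `q i`: either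
some `q j` sees many of them, or for many `i` the `q i` see only their own set and form a clique
or an independent set. -/
theorem exists_attachment_dichotomy (m : ℕ) : ∃ M : ℕ, ∀ {V : Type*} (G : SimpleGraph V)
    {β : Type*} (φ : Fin M → β → V) (q : Fin M → V), (∀ i, ∃ b, G.Adj (q i) (φ i b)) →
      (∃ (j : Fin M) (f : Fin m ↪ Fin M), ∀ k, ∃ b, G.Adj (q j) (φ (f k) b)) ∨
      ∃ f : Fin m ↪ Fin M,
        (∀ k k', k ≠ k' → q (f k) ≠ q (f k') ∧ ∀ b, ¬ G.Adj (q (f k)) (φ (f k') b)) ∧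
        ((∀ k k', k ≠ k' → G.Adj (q (f k)) (q (f k'))) ∨
          ∀ k k', k ≠ k' → ¬ G.Adj (q (f k)) (q (f k'))) := by
  classical
  obtain ⟨N₃, h₃⟩ := exists_ramsey m m
  obtain ⟨N₂, h₂⟩ := exists_ramsey (m + 1) N₃
  obtain ⟨N₁, h₁⟩ := exists_ramsey (m + 1) N₂
  refine ⟨N₁, fun {V} G {β} φ q hq => ?_⟩
  -- The relation "`q i` sees set `j`" is not symmetric, so the directions `i < j` and `i > j` take
  -- one application each. In a homogeneous set of size `m + 1`, the least (then the greatest) index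
  -- sees the other `m` sets.
  rcases h₁ (fun i j => ∃ b, G.Adj (q i) (φ j b)) Finset.univ (by simp) with
    ⟨T, -, hT, hP⟩ | ⟨T₁, -, hT₁, hP₁⟩
  · have hne : T.Nonempty := Finset.card_pos.mp (by omega)
    obtain ⟨f, hf⟩ := exists_embedding_of_card_le (m := m) (T := T.erase (T.min' hne))
      (by rw [Finset.card_erase_of_mem (T.min'_mem hne)]; omega)
    refine Or.inl ⟨T.min' hne, f, fun k => hP _ (T.min'_mem hne) _
      (Finset.mem_of_mem_erase (hf k)) (T.min'_lt_of_mem_erase_min' hne (hf k))⟩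
  rcases h₂ (fun i j => ∃ b, G.Adj (q j) (φ i b)) T₁ hT₁.ge with
    ⟨T, -, hT, hP⟩ | ⟨T₂, hT₂₁, hT₂, hP₂⟩
  · have hne : T.Nonempty := Finset.card_pos.mp (by omega)
    obtain ⟨f, hf⟩ := exists_embedding_of_card_le (m := m) (T := T.erase (T.max' hne))
      (by rw [Finset.card_erase_of_mem (T.max'_mem hne)]; omega)
    refine Or.inl ⟨T.max' hne, f, fun k => hP _ (Finset.mem_of_mem_erase (hf k)) _
      (T.max'_mem hne) (T.lt_max'_of_mem_erase_max' hne (hf k))⟩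
  have hsee : ∀ i ∈ T₂, ∀ j ∈ T₂, i ≠ j → ∀ b, ¬ G.Adj (q i) (φ j b) := by
    intro i hi j hj hij b hb
    rcases lt_or_gt_of_ne hij with h | h
    · exact hP₁ i (hT₂₁ hi) j (hT₂₁ hj) h ⟨b, hb⟩
    · exact hP₂ j hj i hi h ⟨b, hb⟩
  have hfin : ∀ T ⊆ T₂, T.card = m → ∃ f : Fin m ↪ Fin N₁, (∀ k, f k ∈ T) ∧
      ∀ k k', k ≠ k' → q (f k) ≠ q (f k') ∧ ∀ b, ¬ G.Adj (q (f k)) (φ (f k') b) := by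
    intro T hT hTm
    obtain ⟨f, hf⟩ := exists_embedding_of_card_le hTm.ge
    refine ⟨f, hf, fun k k' hk => ?_⟩
    have := hsee _ (hT (hf k)) _ (hT (hf k')) (f.injective.ne hk)
    refine ⟨fun h => ?_, this⟩
    -- Distinctness comes for free: `q (f k')` sees its own set, which `q (f k)` does not.
    obtain ⟨b, hb⟩ := hq (f k')
    exact this b (h ▸ hb)
  refine Or.inr ?_
  rcases h₃ (fun i j => G.Adj (q i) (q j)) T₂ hT₂.ge with ⟨T, hT, hTm, hP⟩ | ⟨T, hT, hTm, hP⟩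
  · obtain ⟨f, hf, hf'⟩ := hfin T hT hTm
    refine ⟨f, hf', Or.inl fun k k' hk => ?_⟩
    rcases lt_or_gt_of_ne (f.injective.ne hk) with h | h
    · exact hP _ (hf k) _ (hf k') h
    · exact (hP _ (hf k') _ (hf k) h).symm
  · obtain ⟨f, hf, hf'⟩ := hfin T hT hTm
    refine ⟨f, hf', Or.inr fun k k' hk => ?_⟩
    rcases lt_or_gt_of_ne (f.injective.ne hk) with h | h
    · exact hP _ (hf k) _ (hf k') h
    · exact fun h' => hP _ (hf k') _ (hf k) h h'.symm

end Ramsey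

/-! ### Distance levels and geodesics. -/

section Distance

variable {V : Type*} {G : SimpleGraph V}

theorem dist_le_dist_add_one_of_adj (hG : G.Connected) (r : V) {u v : V} (h : G.Adj u v) :
    G.dist r v ≤ G.dist r u + 1 :=
  hG.dist_triangle.trans (by rw [dist_eq_one_iff_adj.mpr h])

theorem dist_getVert_of_length_eq_dist (hG : G.Connected) {r v : V} (p : G.Walk r v)
    (hp : p.length = G.dist r v) {k : ℕ} (hk : k ≤ p.length) : G.dist r (p.getVert k) = k := by
  have h₁ := dist_le (p.take k)
  have h₂ := dist_le (p.drop k)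
  have h₃ := hG.dist_triangle (u := r) (v := p.getVert k) (w := v)
  rw [Walk.take_length] at h₁
  rw [Walk.drop_length] at h₂
  omega

theorem exists_adj_dist_eq (hG : G.Connected) {r v : V} {e : ℕ} (h : G.dist r v = e + 1) :
    ∃ q, G.Adj q v ∧ G.dist r q = e := by
  obtain ⟨p, hp⟩ := hG.exists_walk_length_eq_dist r v
  refine ⟨p.getVert e, ?_, dist_getVert_of_length_eq_dist hG p hp (by omega)⟩
  have := p.adj_getVert_succ (i := e) (by omega)
  rwa [← h, ← hp, p.getVert_length] at this

/-- The `i`-th vertex of a geodesic from `r` is at distance `i`, and adjacent vertices differ in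
distance by at most 1, so a geodesic has no chords. -/
theorem pathGraph_isIndContained_of_le_dist (hG : G.Connected) {r v : V} {n : ℕ}
    (h : n ≤ G.dist r v + 1) : (pathGraph n).IsIndContained G := by
  obtain ⟨p, hp⟩ := hG.exists_walk_length_eq_dist r v
  have hd : ∀ i : Fin n, G.dist r (p.getVert i) = i := fun i =>
    dist_getVert_of_length_eq_dist hG p hp (by omega)
  have hinj : Function.Injective fun i : Fin n => p.getVert i := fun i j hij => by
    have := congrArg (G.dist r) hij
    simp only [hd] at this
    exact Fin.ext this
  refine ⟨⟨⟨_, hinj⟩, fun {i j} => ?_⟩⟩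
  simp only [Function.Embedding.coeFn_mk, pathGraph_adj]
  constructor
  · intro hij
    have h₁ := dist_le_dist_add_one_of_adj hG r hij
    have h₂ := dist_le_dist_add_one_of_adj hG r hij.symm
    have h₃ : (i : ℕ) ≠ j := fun h => hij.ne (by rw [h])
    rw [hd, hd] at h₁ h₂
    omega
  · rintro (hij | hij)
    · rw [← hij]
      exact p.adj_getVert_succ (by omega)
    · rw [← hij]
      exact (p.adj_getVert_succ (by omega)).symm

end Distance

/-! ### Assembling cliques and stars of copies from embedded pieces. -/

section Gluing

variable {V β : Type*} {G : SimpleGraph V} {B : SimpleGraph β} {r : β} {n : ℕ}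

/-- A graph embedding from an injection that preserves and reflects adjacency. -/
def embeddingOfAdjIff (f : β → V) (hf : Function.Injective f)
    (h : ∀ a b, G.Adj (f a) (f b) ↔ B.Adj a b) : B ↪g G :=
  ⟨⟨f, hf⟩, h _ _⟩

theorem cliqueOfCopies_isIndContained (ψ : Fin n → (B ↪g G))
    (hne : ∀ i j, i ≠ j → ∀ b c, ψ i b ≠ ψ j c)
    (hadj : ∀ i j, i ≠ j → ∀ b c, G.Adj (ψ i b) (ψ j c) ↔ b = r ∧ c = r) :
    (cliqueOfCopies n B r).IsIndContained G := by
  refine ⟨embeddingOfAdjIff (fun p => ψ p.1 p.2) ?_ ?_⟩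
  · rintro ⟨i, b⟩ ⟨j, c⟩ h
    by_cases hij : i = j
    · subst hij
      obtain rfl : b = c := (ψ i).injective h
      rfl
    · exact absurd h (hne i j hij b c)
  · rintro ⟨i, b⟩ ⟨j, c⟩
    by_cases hij : i = j
    · subst hij
      simp [cliqueOfCopies]
    · simp [cliqueOfCopies, hij, hadj i j hij]

theorem starOfCopies_isIndContained (ψ : Fin n → (B ↪g G)) {v : V} (hv : ∀ i, ψ i r = v)
    (hanti : ∀ i j, i ≠ j → ∀ b c, b ≠ r → c ≠ r → ψ i b ≠ ψ j c ∧ ¬ G.Adj (ψ i b) (ψ j c)) :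
    (starOfCopies n B r).IsIndContained G := by
  refine ⟨embeddingOfAdjIff (fun p => p.elim v fun p => ψ p.1 p.2) ?_ ?_⟩
  · rintro (_ | ⟨i, b, hb⟩) (_ | ⟨j, c, hc⟩) h
    · rfl
    · exact absurd ((ψ j).injective ((hv j).trans h)).symm hc
    · exact absurd ((ψ i).injective ((hv i).trans h.symm)).symm hb
    · by_cases hij : i = j
      · subst hij
        obtain rfl : b = c := (ψ i).injective h
        rfl
      · exact absurd h (hanti i j hij b c hb hc).1
  · rintro (_ | ⟨i, b, hb⟩) (_ | ⟨j, c, hc⟩)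
    · simp [starOfCopies]
    · simp [starOfCopies, ← hv j]
    · simp [starOfCopies, ← hv i]
    · by_cases hij : i = j
      · subst hij
        simp [starOfCopies]
      · simp [starOfCopies, hij, (hanti i j hij b c hb hc).2]

end Gluing

/-! ### Families of brooms and their extension towards the root. -/

section Brooms

variable {V W : Type*} {G : SimpleGraph V} {H : SimpleGraph W} {X : Set W} {l : ℕ}

theorem broom_adj_inl_inl {a b : Fin l} :
    (broom H X l).Adj (.inl a) (.inl b) ↔ a.val + 1 = b ∨ b.val + 1 = a :=
  pathGraph_adj

theorem broom_adj_inl_inr {a : Fin l} {x : W} :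
    (broom H X l).Adj (.inl a) (.inr x) ↔ a.val + 1 = l ∧ x ∈ X :=
  Iff.rfl

theorem broom_adj_inr_inl {a : Fin l} {x : W} :
    (broom H X l).Adj (.inr x) (.inl a) ↔ a.val + 1 = l ∧ x ∈ X :=
  Iff.rfl

theorem broom_adj_inr_inr {x y : W} : (broom H X l).Adj (.inr x) (.inr y) ↔ H.Adj x y :=
  Iff.rfl

/-- Lengthening a broom by a vertex `p`, which becomes the new endpoint. -/
theorem exists_broom_succ {X' : Set W} (φ : broom H X l ↪g G) (p : V)
    (hp : ∀ b, p ≠ φ b) (hr : ∀ w, G.Adj p (φ (.inr w)) ↔ l = 0 ∧ w ∈ X')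
    (hl : ∀ k : Fin l, G.Adj p (φ (.inl k)) ↔ k.val = 0) (hX : 0 < l → X = X') :
    ∃ ψ : broom H X' (l + 1) ↪g G, ψ (broomEndpoint W l.succ_pos) = p ∧
      ∀ b, b ≠ broomEndpoint W l.succ_pos → ∃ c, ψ b = φ c := by
  let g : Fin (l + 1) ⊕ W → V :=
    Sum.elim (Fin.cons p fun k => φ (.inl k)) fun w => φ (.inr w)
  have hg : Function.Injective g := by
    rintro (a | x) (b | y) h
    · induction a using Fin.cases <;> induction b using Fin.cases
      · rfl
      · exact absurd h (hp _)
      · exact absurd h.symm (hp _)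
      · simpa [g] using h
    · induction a using Fin.cases
      · exact absurd h (hp _)
      · simp [g] at h
    · induction b using Fin.cases
      · exact absurd h.symm (hp _)
      · simp [g] at h
    · simpa [g] using h
  refine ⟨embeddingOfAdjIff g hg ?_, rfl, ?_⟩
  · rintro (a | x) (b | y)
    · induction a using Fin.cases <;> induction b using Fin.cases <;>
        simp [g, broom_adj_inl_inl, hl, G.adj_comm _ p]
    · induction a using Fin.cases
      · simp [g, broom_adj_inl_inr, hr]
      · rename_i k
        simp [g, broom_adj_inl_inr, hX k.pos]
    · induction b using Fin.cases
      · simp [g, broom_adj_inr_inl, hr, G.adj_comm _ p]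
      · rename_i k
        simp [g, broom_adj_inr_inl, hX k.pos]
    · simp [g, broom_adj_inr_inr]
  · rintro (a | x) h
    · induction a using Fin.cases
      · exact absurd rfl h
      · exact ⟨_, rfl⟩
    · exact ⟨_, rfl⟩

/-- `φ` is a family of pairwise disjoint and non-adjacent induced brooms (copies of `H` if
`l = 0`), each at distance exactly `e` from `r`, where the distance is attained at the endpoint
only (if there is one). -/
structure IsBroomFamily (G : SimpleGraph V) (r : V) (e : ℕ) {m : ℕ}
    (φ : Fin m → (broom H X l ↪g G)) : Prop where
  ne : ∀ i j, i ≠ j → ∀ b c, φ i b ≠ φ j c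
  not_adj : ∀ i j, i ≠ j → ∀ b c, ¬ G.Adj (φ i b) (φ j c)
  le_dist : ∀ i b, e ≤ G.dist r (φ i b)
  exists_dist_eq : ∀ i, ∃ b, G.dist r (φ i b) = e
  eq_of_dist_eq : ∀ i b, G.dist r (φ i b) = e → l = 0 ∨ ∃ k : Fin l, b = .inl k ∧ k.val = 0

theorem IsBroomFamily.comp {r : V} {e m m' : ℕ} {φ : Fin m → (broom H X l ↪g G)}
    (h : IsBroomFamily G r e φ) (f : Fin m' ↪ Fin m) :
    IsBroomFamily G r e fun i => φ (f i) where
  ne _ _ hij := h.ne _ _ (f.injective.ne hij)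
  not_adj _ _ hij := h.not_adj _ _ (f.injective.ne hij)
  le_dist _ := h.le_dist _
  exists_dist_eq _ := h.exists_dist_eq _
  eq_of_dist_eq _ := h.eq_of_dist_eq _

/-- Lengthening many brooms of a family by vertices closer to the root. -/
theorem IsBroomFamily.exists_succ [Finite W] (hG : G.Connected) {r : V} {e M m : ℕ}
    (hX : X.Nonempty) {φ : Fin M → (broom H X l ↪g G)} (h : IsBroomFamily G r (e + 1) φ)
    (hm : 0 < m) (hM : Nat.card (Set W) * m ≤ M) (q : Fin M → V) (hq : ∀ i, G.dist r (q i) = e)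
    (hadj : ∀ i, ∃ b, G.Adj (q i) (φ i b)) :
    ∃ X' : Set W, X'.Nonempty ∧ ∃ (f : Fin m ↪ Fin M) (ψ : Fin m → (broom H X' (l + 1) ↪g G)),
      (∀ k, ψ k (broomEndpoint W l.succ_pos) = q (f k)) ∧
      ∀ k b, b ≠ broomEndpoint W l.succ_pos → ∃ c, ψ k b = φ (f k) c := by
  have hne : ∀ i b, q i ≠ φ i b := fun i b hb => by
    have := h.le_dist i b
    rw [← hb, hq] at this
    omega
  have hdist : ∀ i b, G.Adj (q i) (φ i b) → G.dist r (φ i b) = e + 1 := fun i b hb => by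
    have h₁ := dist_le_dist_add_one_of_adj hG r hb
    have h₂ := h.le_dist i b
    rw [hq] at h₁
    omega
  rcases Nat.eq_zero_or_pos l with rfl | hl
  -- With no path yet, the new vertex may attach to any part of `H`; pigeonhole over the subsets of
  -- `W` makes this part the same for all.
  · obtain ⟨X', f, hf⟩ := exists_embedding_const
      (fun i => {w | G.Adj (q i) (φ i (.inr w))}) hM
    have hf' : ∀ k w, w ∈ X' ↔ G.Adj (q (f k)) (φ (f k) (.inr w)) := fun k w => by
      rw [← hf k]; rfl
    choose ψ hψ using fun k => exists_broom_succ (X' := X') (φ (f k)) (q (f k)) (hne _)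
      (by simp [hf' k]) (fun k => k.elim0) (by simp)
    refine ⟨X', ?_, f, ψ, fun k => (hψ k).1, fun k => (hψ k).2⟩
    obtain ⟨b | w, hb⟩ := hadj (f ⟨0, hm⟩)
    · exact b.elim0
    · exact ⟨w, (hf' _ w).mpr hb⟩
  -- A neighbour of `q i` in its broom is at distance `e + 1`, so it can only be the endpoint; `X`
  -- is unchanged.
  · have key : ∀ i b, G.Adj (q i) (φ i b) → ∃ k : Fin l, b = .inl k ∧ k.val = 0 := fun i b hb =>
      (h.eq_of_dist_eq i b (hdist i b hb)).resolve_left hl.ne'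
    have hend : ∀ i (k : Fin l), k.val = 0 → G.Adj (q i) (φ i (.inl k)) := fun i k hk => by
      obtain ⟨b, hb⟩ := hadj i
      obtain ⟨k', rfl, hk'⟩ := key i b hb
      rwa [Fin.ext (hk.trans hk'.symm)]
    choose ψ hψ using fun i => exists_broom_succ (X' := X) (φ i) (q i) (hne i)
      (fun w => ⟨fun hw => by simpa using key i _ hw, fun hw => absurd hw.1 hl.ne'⟩)
      (fun k => ⟨fun hk => by
        obtain ⟨k', hk', h0⟩ := key i _ hk
        rwa [Sum.inl.inj hk'], hend i k⟩) (fun _ => rfl)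
    have hmM : m ≤ M := (Nat.le_mul_of_pos_left m Nat.card_pos).trans hM
    exact ⟨X, hX, Fin.castLEEmb hmM, fun k => ψ (Fin.castLE hmM k), fun k => (hψ _).1,
      fun k => (hψ _).2⟩

/-- One step towards the root: a large family of brooms yields a hairy graph, a star, or
a family of longer brooms that is closer to the root. -/
theorem exists_family_step (C n m : ℕ) (hn : 0 < n) : ∃ M : ℕ, ∀ {V W : Type*} [Finite W]
    {G : SimpleGraph V} {H : SimpleGraph W} {X : Set W} {l e : ℕ} {r : V}
    {φ : Fin M → (broom H X l ↪g G)}, G.Connected → Nat.card (Set W) ≤ C → X.Nonempty →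
    IsBroomFamily G r (e + 1) φ → ∃ X' : Set W, X'.Nonempty ∧
      ((hairyGraph H X' n l.succ_pos).IsIndContained G ∨
        (starGraph H X' n l.succ_pos).IsIndContained G ∨
        ∃ ψ : Fin m → (broom H X' (l + 1) ↪g G), IsBroomFamily G r e ψ) := by
  -- The factor `C` pays for the pigeonhole over subsets; `n + m` brooms suffice both for a hairy
  -- graph or star (`n`) and for the next family (`m`).
  obtain ⟨M, hM⟩ := exists_attachment_dichotomy (C * (n + m))
  refine ⟨M, fun {V W _ G H X l e r φ} hG hC hX h => ?_⟩
  have hC' : Nat.card (Set W) * (n + m) ≤ C * (n + m) := Nat.mul_le_mul_right _ hC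
  have hpar : ∀ i, ∃ q, (∃ b, G.Adj q (φ i b)) ∧ G.dist r q = e := fun i => by
    obtain ⟨b, hb⟩ := h.exists_dist_eq i
    obtain ⟨q, hq, hqe⟩ := exists_adj_dist_eq hG hb
    exact ⟨q, ⟨b, hq⟩, hqe⟩
  choose q hq hqe using hpar
  rcases hM G (fun i => φ i) q hq with ⟨j, f, hf⟩ | ⟨f, hf, hcl⟩
  · obtain ⟨X', hX', f', ψ, hψ, hψ'⟩ := (h.comp f).exists_succ hG hX (by omega) hC'
      (fun _ => q j) (fun _ => hqe j) hf
    refine ⟨X', hX', Or.inr (Or.inl ?_)⟩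
    refine starOfCopies_isIndContained (fun k => ψ (Fin.castLE (Nat.le_add_right n m) k))
      (fun k => hψ _) fun i j hij b c hb hc => ?_
    obtain ⟨b', hb'⟩ := hψ' (Fin.castLE (Nat.le_add_right n m) i) b hb
    obtain ⟨c', hc'⟩ := hψ' (Fin.castLE (Nat.le_add_right n m) j) c hc
    have hne := f.injective.ne (f'.injective.ne
      ((Fin.castLE_injective (Nat.le_add_right n m)).ne hij))
    rw [hb', hc']
    exact ⟨h.ne _ _ hne _ _, h.not_adj _ _ hne _ _⟩
  · obtain ⟨X', hX', f', ψ, hψ, hψ'⟩ := (h.comp f).exists_succ hG hX (by omega) hC'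
      (fun i => q (f i)) (fun _ => hqe _) (fun i => hq (f i))
    have hne : ∀ i j, i ≠ j → ∀ b c, ψ i b ≠ ψ j c := fun i j hij b c => by
      have hij' := f'.injective.ne hij
      by_cases hb : b = broomEndpoint W l.succ_pos <;>
        by_cases hc : c = broomEndpoint W l.succ_pos
      · rw [hb, hc, hψ, hψ]
        exact (hf _ _ hij').1
      · obtain ⟨c', hc'⟩ := hψ' j c hc
        rw [hb, hψ, hc']
        intro heq
        have := h.le_dist (f (f' j)) c'
        rw [← heq, hqe] at this
        omega
      · obtain ⟨b', hb'⟩ := hψ' i b hb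
        rw [hc, hψ, hb']
        intro heq
        have := h.le_dist (f (f' i)) b'
        rw [heq, hqe] at this
        omega
      · obtain ⟨b', hb'⟩ := hψ' i b hb
        obtain ⟨c', hc'⟩ := hψ' j c hc
        rw [hb', hc']
        exact h.ne _ _ (f.injective.ne hij') _ _
    have hadj : ∀ i j, i ≠ j → ∀ b c, G.Adj (ψ i b) (ψ j c) →
        b = broomEndpoint W l.succ_pos ∧ c = broomEndpoint W l.succ_pos := by
      intro i j hij b c hbc
      have hij' := f'.injective.ne hij
      by_cases hb : b = broomEndpoint W l.succ_pos <;>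
        by_cases hc : c = broomEndpoint W l.succ_pos
      · exact ⟨hb, hc⟩
      · obtain ⟨c', hc'⟩ := hψ' j c hc
        rw [hb, hψ, hc'] at hbc
        exact absurd hbc ((hf _ _ hij').2 c')
      · obtain ⟨b', hb'⟩ := hψ' i b hb
        rw [hc, hψ, hb'] at hbc
        exact absurd hbc.symm ((hf _ _ hij'.symm).2 b')
      · obtain ⟨b', hb'⟩ := hψ' i b hb
        obtain ⟨c', hc'⟩ := hψ' j c hc
        rw [hb', hc'] at hbc
        exact absurd hbc (h.not_adj _ _ (f.injective.ne hij') _ _)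
    refine ⟨X', hX', ?_⟩
    rcases hcl with hcl | hcl
    · refine Or.inl (cliqueOfCopies_isIndContained
        (fun k => ψ (Fin.castLE (Nat.le_add_right n m) k)) (fun i j hij => hne _ _
          ((Fin.castLE_injective _).ne hij)) fun i j hij b c => ?_)
      have hij' := (Fin.castLE_injective (Nat.le_add_right n m)).ne hij
      refine ⟨hadj _ _ hij' b c, ?_⟩
      rintro ⟨rfl, rfl⟩
      rw [hψ, hψ]
      exact hcl _ _ (f'.injective.ne hij')
    · refine Or.inr (Or.inr ⟨_, IsBroomFamily.comp (φ := ψ) ⟨hne, ?_, ?_, ?_, ?_⟩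
        (Fin.castLEEmb (Nat.le_add_left m n))⟩)
      · intro i j hij b c hbc
        obtain ⟨rfl, rfl⟩ := hadj i j hij b c hbc
        rw [hψ, hψ] at hbc
        exact hcl _ _ (f'.injective.ne hij) hbc
      · intro i b
        by_cases hb : b = broomEndpoint W l.succ_pos
        · rw [hb, hψ, hqe]
        · obtain ⟨b', hb'⟩ := hψ' i b hb
          rw [hb']
          exact (Nat.le_succ e).trans (h.le_dist _ _)
      · exact fun i => ⟨_, by rw [hψ, hqe]⟩
      · intro i b hb
        by_cases hb' : b = broomEndpoint W l.succ_pos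
        · exact Or.inr ⟨_, hb', rfl⟩
        · obtain ⟨c, hc⟩ := hψ' i b hb'
          have := h.le_dist (f (f' i)) c
          rw [hc] at hb
          omega

/-- Copies of `H`, regarded as brooms of length `0`. -/
def broomZeroIso (H : SimpleGraph W) (X : Set W) : broom H X 0 ≃g H where
  toEquiv := Equiv.emptySum (Fin 0) W
  map_rel_iff' := by
    rintro (a | x) (b | y)
    · exact a.elim0
    · exact a.elim0
    · exact b.elim0
    · exact Iff.rfl

/-- The path of a broom. -/
def pathEmbeddingBroom (H : SimpleGraph W) (X : Set W) (l : ℕ) : pathGraph l ↪g broom H X l where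
  toFun := Sum.inl
  inj' := Sum.inl_injective
  map_rel_iff' := Iff.rfl

/-- Forgetting the bristles of the brooms in a family, so that only their paths remain. -/
theorem IsBroomFamily.exists_path {W' : Type*} {H' : SimpleGraph W'} {r : V} {e m : ℕ}
    {φ : Fin m → (broom H X l ↪g G)} (h : IsBroomFamily G r e φ) (hl : l ≠ 0)
    (iso : pathGraph l ≃g H') :
    ∃ φ' : Fin m → (broom H' Set.univ 0 ↪g G), IsBroomFamily G r e φ' := by
  refine ⟨fun i => (φ i).comp ((pathEmbeddingBroom H X l).comp
    (iso.symm.toEmbedding.comp (broomZeroIso H' Set.univ).toEmbedding)), ?_⟩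
  refine ⟨fun i j hij b c => h.ne i j hij _ _, fun i j hij b c => h.not_adj i j hij _ _,
    fun i b => h.le_dist i _, fun i => ?_, fun _ _ _ => Or.inl rfl⟩
  -- The minimum distance is attained at the endpoint, which lies on the path and so survives.
  obtain ⟨b, hb⟩ := h.exists_dist_eq i
  obtain ⟨k, rfl, -⟩ := (h.eq_of_dist_eq i b hb).resolve_left hl
  refine ⟨.inr (iso k), ?_⟩
  rw [← hb]
  exact congrArg (fun k => G.dist r (φ i (.inl k))) (iso.symm_apply_apply k)

end Brooms

/-! ### Induction on the distance, and the initial family. -/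

section Main

/-- `G` contains one of the large hairy graphs or stars. -/
def HasHairyOrStar {ι : Type*} {W : ι → Type*} (H : ∀ i, SimpleGraph (W i)) (s n : ℕ)
    {V : Type*} (G : SimpleGraph V) : Prop :=
  (∃ (l : ℕ) (hl : 0 < l), l ≤ s ∧ ∃ (i : ι) (X : Set (W i)), X.Nonempty ∧
    (hairyGraph (H i) X n hl).IsIndContained G) ∨
  (∃ (l : ℕ) (hl : 0 < l), l ≤ s ∧ ∃ (i : ι) (X : Set (W i)), X.Nonempty ∧
    (starGraph (H i) X n hl).IsIndContained G)

/-- Induction on `e`. The bound is uniform in `i`, `X` and `l`, since all three may change along the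
way. -/
theorem exists_hasHairyOrStar_of_family {ι : Type*} [Finite ι] {W : ι → Type*} [∀ i, Finite (W i)]
    (H : ∀ i, SimpleGraph (W i)) {s : ℕ} (hs : 0 < s) {i₀ : ι} (iso : pathGraph s ≃g H i₀)
    {n : ℕ} (hn : 0 < n) (e : ℕ) :
    ∃ M : ℕ, ∀ {V : Type*} {G : SimpleGraph V} {r : V} {i : ι} {X : Set (W i)} {l : ℕ}
      {φ : Fin M → (broom (H i) X l ↪g G)}, G.Connected → X.Nonempty → l ≤ s →
      IsBroomFamily G r e φ → HasHairyOrStar H s n G := by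
  obtain ⟨C, hC⟩ : ∃ C, ∀ i, Nat.card (Set (W i)) ≤ C :=
    ⟨_, fun i => le_csSup (Set.finite_range fun i => Nat.card (Set (W i))).bddAbove ⟨i, rfl⟩⟩
  induction e with
  | zero =>
    -- Two disjoint brooms at distance `0` would both contain `r`.
    refine ⟨2, fun {V G r i X l φ} hG _ _ h => ?_⟩
    obtain ⟨b, hb⟩ := h.exists_dist_eq 0
    obtain ⟨c, hc⟩ := h.exists_dist_eq 1
    rw [hG.dist_eq_zero_iff] at hb hc
    exact absurd (hb.symm.trans hc) (h.ne 0 1 (by simp) b c)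
  | succ e ih =>
    obtain ⟨m, hm⟩ := ih
    obtain ⟨M, hM⟩ := exists_family_step C n m hn
    have main : ∀ {V : Type _} {G : SimpleGraph V} {r : V} {i : ι} {X : Set (W i)} {l : ℕ}
        {φ : Fin M → (broom (H i) X l ↪g G)}, G.Connected → X.Nonempty → l < s →
        IsBroomFamily G r (e + 1) φ → HasHairyOrStar H s n G := by
      intro V G r i X l φ hG hX hl h
      obtain ⟨X', hX', hh | hh | ⟨ψ, hψ⟩⟩ := hM hG (hC i) hX h
      · exact Or.inl ⟨l + 1, l.succ_pos, hl, i, X', hX', hh⟩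
      · exact Or.inr ⟨l + 1, l.succ_pos, hl, i, X', hX', hh⟩
      · exact hm hG hX' hl hψ
    refine ⟨M, fun {V G r i X l φ} hG hX hl h => ?_⟩
    rcases hl.lt_or_eq with hl | rfl
    · exact main hG hX hl h
    -- At full length, restart from the paths as copies of `H i₀`, at the same distance.
    · obtain ⟨φ', hφ'⟩ := h.exists_path hs.ne' iso
      exact main hG ⟨iso ⟨0, hs⟩, Set.mem_univ _⟩ hs hφ'

theorem exists_isInducedMatching_of_le {ι : Type*} {W : ι → Type*} {H : ∀ i, SimpleGraph (W i)}
    {V : Type*} {G : SimpleGraph V} {N : ℕ} (hN : 0 < N) (h : N ≤ inducedMatchingNumber H G) :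
    ∃ S : Set V, IsInducedMatching H G S ∧ N ≤ Nat.card (G.induce S).ConnectedComponent := by
  by_contra! hcon
  have : inducedMatchingNumber H G ≤ N - 1 := by
    refine csSup_le' ?_
    rintro k ⟨S, hS, rfl⟩
    have := hcon S hS
    omega
  omega

/-- Pigeonhole on the pair (isomorphism type, distance from `r`) of a component. Distinct components
are disjoint and non-adjacent. The set `Set.univ` is a placeholder, as a broom of length `0` has no
path to attach. -/
theorem exists_family_of_isInducedMatching {ι : Type*} [Finite ι] [Nonempty ι] {W : ι → Type*}
    {H : ∀ i, SimpleGraph (W i)} {V : Type*} {G : SimpleGraph V} {n m : ℕ} {r : V}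
    (hn : ∀ v, G.dist r v < n) {S : Set V} (hS : IsInducedMatching H G S)
    (hm : Nat.card (ι × Fin n) * m ≤ Nat.card (G.induce S).ConnectedComponent) :
    ∃ (i : ι) (e : Fin n) (φ : Fin m → (broom (H i) Set.univ 0 ↪g G)),
      IsBroomFamily G r e φ := by
  classical
  rcases Nat.eq_zero_or_pos m with rfl | hm0
  · exact ⟨Classical.arbitrary ι, ⟨_, hn r⟩, fun k => k.elim0, fun k => k.elim0, fun k => k.elim0,
      fun k => k.elim0, fun k => k.elim0, fun k => k.elim0⟩
  choose t iso using hS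
  have : Nonempty (Fin n) := ⟨⟨_, hn r⟩⟩
  have hpos : 0 < Nat.card (ι × Fin n) := Nat.card_pos
  have : Finite (G.induce S).ConnectedComponent := Nat.finite_of_card_ne_zero
    ((Nat.mul_pos hpos hm0).trans_le hm).ne'
  have emb := Finite.equivFin (G.induce S).ConnectedComponent
  have hmin : ∀ c : (G.induce S).ConnectedComponent, ∃ e : Fin n,
      (∀ v ∈ c.supp, (e : ℕ) ≤ G.dist r v) ∧ ∃ v ∈ c.supp, G.dist r v = e := fun c => by
    obtain ⟨v, hv, hmin⟩ := exists_minimalFor_of_wellFoundedLT (· ∈ c.supp)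
      (fun v : S => G.dist r v) c.nonempty_supp
    refine ⟨⟨_, hn v⟩, fun w hw => ?_, v, hv, rfl⟩
    by_contra! hlt
    exact absurd (hmin hw hlt.le) (not_le.mpr hlt)
  choose lev hlev hlev' using hmin
  obtain ⟨⟨i, e⟩, f, hf⟩ := exists_embedding_const
    (fun k => (t (emb.symm k), lev (emb.symm k))) hm
  simp only [Prod.mk.injEq] at hf
  have hφ : ∀ c : (G.induce S).ConnectedComponent, t c = i → ∃ φ : broom (H i) Set.univ 0 ↪g G,
      (∀ b, ∃ v ∈ c.supp, φ b = v) ∧ ∀ v ∈ c.supp, ∃ b, φ b = v := by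
    rintro c rfl
    obtain ⟨iso⟩ := iso c
    refine ⟨(Embedding.induce S).comp ((Embedding.induce c.supp).comp
      (iso.symm.toEmbedding.comp (broomZeroIso _ _).toEmbedding)), fun b => ?_, fun v hv => ?_⟩
    · exact ⟨_, (iso.symm (broomZeroIso _ _ b)).2, rfl⟩
    · refine ⟨.inr (iso ⟨v, hv⟩), ?_⟩
      exact congrArg (fun x : c.supp => (x.1 : V)) (iso.symm_apply_apply ⟨v, hv⟩)
  choose φ hφ₁ hφ₂ using fun k => hφ (emb.symm (f k)) (hf k).1
  have hdisj : ∀ k k', k ≠ k' → emb.symm (f k) ≠ emb.symm (f k') := fun k k' hk =>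
    emb.symm.injective.ne (f.injective.ne hk)
  refine ⟨i, e, φ, fun k k' hk b c heq => ?_, fun k k' hk b c hadj => ?_, fun k b => ?_,
    fun k => ?_, fun _ _ _ => Or.inl rfl⟩
  · obtain ⟨v, hv, hvb⟩ := hφ₁ k b
    obtain ⟨w, hw, hwc⟩ := hφ₁ k' c
    obtain rfl : v = w := Subtype.ext (hvb.symm.trans (heq.trans hwc))
    exact hdisj k k' hk (hv.symm.trans hw)
  · obtain ⟨v, hv, hvb⟩ := hφ₁ k b
    obtain ⟨w, hw, hwc⟩ := hφ₁ k' c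
    rw [hvb, hwc] at hadj
    have : (G.induce S).Adj v w := hadj
    exact hdisj k k' hk (hv.symm.trans ((ConnectedComponent.sound this.reachable).trans hw))
  · obtain ⟨v, hv, hvb⟩ := hφ₁ k b
    rw [hvb, ← (hf k).2]
    exact hlev _ v hv
  · obtain ⟨v, hv, hve⟩ := hlev' (emb.symm (f k))
    obtain ⟨b, hb⟩ := hφ₂ k v hv
    exact ⟨b, by rw [hb, hve, (hf k).2]⟩

end Main

end InducedPacking

theorem theorem5 (s : ℕ) (hs : 1 ≤ s)
    {ι : Type*} [Finite ι] {W : ι → Type*} [∀ i, Finite (W i)]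
    (H : ∀ i, SimpleGraph (W i)) (hconn : ∀ i, (H i).Connected)
    (hpath : ∃ i, Nonempty (SimpleGraph.pathGraph s ≃g H i))
    (n : ℕ) (hn : 1 ≤ n) :
    ∃ N : ℕ, ∀ (V : Type*) [Finite V] (G : SimpleGraph V), G.Connected →
      N ≤ InducedPacking.inducedMatchingNumber H G →
        (SimpleGraph.pathGraph n).IsIndContained G ∨
        (∃ (l : ℕ) (hl : 0 < l), l ≤ s ∧ ∃ (i : ι) (X : Set (W i)), X.Nonempty ∧
          (InducedPacking.hairyGraph (H i) X n hl).IsIndContained G) ∨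
        (∃ (l : ℕ) (hl : 0 < l), l ≤ s ∧ ∃ (i : ι) (X : Set (W i)), X.Nonempty ∧
          (InducedPacking.starGraph (H i) X n hl).IsIndContained G) := by
  obtain ⟨i₀, ⟨iso⟩⟩ := hpath
  have : Nonempty ι := ⟨i₀⟩
  choose M hM using InducedPacking.exists_hasHairyOrStar_of_family H hs iso hn
  obtain ⟨m, hm⟩ : ∃ m, ∀ e : Fin n, M e ≤ m :=
    ⟨_, fun e => le_csSup (Set.finite_range fun e : Fin n => M e).bddAbove ⟨e, rfl⟩⟩
  -- This leaves `m` components for some pair of type and distance; the `+ 1` only makes the bound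
  -- positive, as `exists_isInducedMatching_of_le` requires.
  refine ⟨Nat.card (ι × Fin n) * m + 1, fun V _ G hG hN => or_iff_not_imp_left.mpr fun hP => ?_⟩
  obtain ⟨S, hS, hcard⟩ := InducedPacking.exists_isInducedMatching_of_le (Nat.succ_pos _) hN
  obtain ⟨r⟩ := hG.nonempty
  obtain ⟨i, e, φ, hφ⟩ := InducedPacking.exists_family_of_isInducedMatching (r := r)
    (fun v => not_le.mp fun h =>
      hP (InducedPacking.pathGraph_isIndContained_of_le_dist hG (h.trans (Nat.le_succ _))))
    hS ((Nat.le_succ _).trans hcard)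
  have : Nonempty (W i) := (hconn i).nonempty
  exact hM e hG Set.univ_nonempty (Nat.zero_le s) (hφ.comp (Fin.castLEEmb (hm e)))
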